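/- Let $\alpha,\beta,\gamma\in\{1,2,\infty\}$, $\mu_1,\mu_2,\rho\ge 0$, $b\in\mathbb R^q$, $d\in\mathbb R^p$, and let $\mathcal A:\mathbb R^{m\times n}\to\mathbb R^q$ and $\mathcal C:\mathbb R^{m\times n}\to\mathbb R^p$ be linear, with $\mathcal A$ of full row rank (i.e. surjective). Consider the composite norm minimization problem $$(\ast)\qquad \min_{X\in\mathbb R^{m\times n}}\ \mu_1\|\sigma(X)\|_\alpha+\mu_2\|\mathcal C(X)-d\|_\beta\quad\text{subject to}\quad \|\mathcal A(X)-b\|_\gamma\le\rho,$$ where $\sigma(X)\in\mathbb R^{\min\{m,n\}}$ is the vector of singular values of $X$. Let $\lambda^{(k)}>0$, $\epsilon^{(k)}$, $\tau^{(k)}$, $\xi^{(k)}$ ($k\ge 1$) be real parameters. A run of the first-order augmented Lagrangian algorithm (FALC) starts from some $X^{(0)}\in\mathbb R^{m\times n}$, puts $\eta=\mu_1\|\sigma(X^{(0)})\|_\alpha+\mu_2\|\mathcal C(X^{(0)})-d\|_\beta$, $\theta_1^{(1)}=0$, $\theta_2^{(1)}=0$, and for $k=1,2,\dots$, with $$P^{(k)}(X,s,y)=\lambda^{(k)}\big(\mu_1\|\sigma(X)\|_\alpha+\mu_2\|s\|_\beta\big)+\tfrac12\|\mathcal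 A(X)+y-b-\lambda^{(k)}\theta_1^{(k)}\|_2^2+\tfrac12\|\mathcal C(X)+s-d-\lambda^{(k)}\theta_2^{(k)}\|_2^2,$$ computes a triple $(X^{(k)},s^{(k)},y^{(k)})\in\mathbb R^{m\times n}\times\mathbb R^p\times\mathbb R^q$ with $\|y^{(k)}\|_\gamma\le\rho$ that satisfies at least one of the following: (a) $P^{(k)}(X^{(k)},s^{(k)},y^{(k)})\le\inf\{P^{(k)}(X,s,y): X\in\mathbb R^{m\times n},\ s\in\mathbb R^p,\ \|y\|_\gamma\le\rho\}+\epsilon^{(k)}$; (b) there is a partial subgradient $(G,g)\in\partial_{X,s}P^{(k)}$ at $(X^{(k)},s^{(k)},y^{(k)})$ with $\sqrt{\|G\|_F^2+\|g\|_2^2}\le\tau^{(k)}$; moreover, with $v=\nabla_yP^{(k)}(X^{(k)},s^{(k)},y^{(k)})$ and $\|\cdot\|_{\gamma^*}$ the dual norm of $\|\cdot\|_\gamma$, $\rho\|v\|_{\gamma^*}+v^Ty^{(k)}\le\xi^{(k)}$; and $\mu_1\|\sigma(X^{(k)})\|_\alpha\le\eta+\frac{\lambda^{(k)}}2\big(\|\theta_1^{(k)}\|_2^2+\|\theta_2^{(k)}\|_2^2\big)$;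 it then updates $\theta_1^{(k+1)}=\theta_1^{(k)}-\frac{\mathcal A(X^{(k)})+y^{(k)}-b}{\lambda^{(k)}}$ and $\theta_2^{(k+1)}=\theta_2^{(k)}-\frac{\mathcal C(X^{(k)})+s^{(k)}-d}{\lambda^{(k)}}$. Suppose that, as $k\to\infty$, each of $\lambda^{(k)},\epsilon^{(k)},\tau^{(k)},\xi^{(k)}$ decreases monotonically to $0$, that $\epsilon^{(k)}/(\lambda^{(k)})^2\le B$ for all $k\ge1$ and some $B>0$, and that $\tau^{(k)}/\lambda^{(k)}\to0$ and $\xi^{(k)}/\lambda^{(k)}\to0$. Then for every such run: 1. if $\mu_1>0$, or if $\mu_2>0$ and $\mathcal C$ is injective, then $(X^{(k)})_{k\ge 0}$ is a bounded sequence; 2. every limit point of $(X^{(k)})$ (the limit of a convergent subsequence) is an optimal solution of $(\ast)$. -/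

import Mathlib

open Set Filter Topology
open scoped ENNReal

noncomputable section

/-- The `ℓ_r` norm of a vector (used with `r ∈ {1, 2, ∞}`). -/
def lrNorm {k : ℕ} (r : ℝ≥0∞) (x : EuclideanSpace ℝ (Fin k)) : ℝ :=
  ‖WithLp.toLp r (fun i => x i)‖

/-- The dual norm of the `ℓ_r` norm with respect to the Euclidean inner product. -/
def dualNorm {k : ℕ} (r : ℝ≥0∞) (v : EuclideanSpace ℝ (Fin k)) : ℝ :=
  sSup {t : ℝ | ∃ w : EuclideanSpace ℝ (Fin k), lrNorm r w ≤ 1 ∧ t = inner ℝ w v}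

/-- The vector of singular values of an `m × n` matrix, in `ℝ^{min{m,n}}`. -/
def singularVector {m n : ℕ} (X : Matrix (Fin m) (Fin n) ℝ) :
    EuclideanSpace ℝ (Fin (min m n)) :=
  WithLp.toLp 2 (fun i => (Matrix.toEuclideanLin X).singularValues i)

/-- The trace inner product of two matrices. -/
def frobInner {m n : ℕ} (X Y : Matrix (Fin m) (Fin n) ℝ) : ℝ :=
  (X.transpose * Y).trace

/-- The Frobenius norm of a matrix. -/
def frobNorm {m n : ℕ} (X : Matrix (Fin m) (Fin n) ℝ) : ℝ :=
  Real.sqrt (frobInner X X)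

/-- The data of the problem
`min μ₁ ‖σ(X)‖_α + μ₂ ‖C(X) - d‖_β` subject to `‖A(X) - b‖_γ ≤ ρ`. -/
structure CompositeProblem (m n p q : ℕ) where
  α : ℝ≥0∞
  β : ℝ≥0∞
  γ : ℝ≥0∞
  μ₁ : ℝ
  μ₂ : ℝ
  ρ : ℝ
  A : Matrix (Fin m) (Fin n) ℝ →ₗ[ℝ] EuclideanSpace ℝ (Fin q)
  b : EuclideanSpace ℝ (Fin q)
  C : Matrix (Fin m) (Fin n) ℝ →ₗ[ℝ] EuclideanSpace ℝ (Fin p)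
  d : EuclideanSpace ℝ (Fin p)

namespace CompositeProblem

variable {m n p q : ℕ} (D : CompositeProblem m n p q)

/-- The objective function. -/
def objective (X : Matrix (Fin m) (Fin n) ℝ) : ℝ :=
  D.μ₁ * lrNorm D.α (singularVector X) + D.μ₂ * lrNorm D.β (D.C X - D.d)

/-- The feasible set. -/
def feasible : Set (Matrix (Fin m) (Fin n) ℝ) :=
  {X | lrNorm D.γ (D.A X - D.b) ≤ D.ρ}

/-- `X` is an optimal solution. -/
def IsOptimal (X : Matrix (Fin m) (Fin n) ℝ) : Prop :=
  X ∈ D.feasible ∧ ∀ Y ∈ D.feasible, D.objective X ≤ D.objective Y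

/-- The smooth part `f` of the augmented Lagrangian subproblem with penalty parameter `l` and
multipliers `θ₁`, `θ₂`. -/
def smoothPart (l : ℝ) (θ₁ : EuclideanSpace ℝ (Fin q)) (θ₂ : EuclideanSpace ℝ (Fin p))
    (X : Matrix (Fin m) (Fin n) ℝ) (s : EuclideanSpace ℝ (Fin p))
    (y : EuclideanSpace ℝ (Fin q)) : ℝ :=
  1 / 2 * ‖D.A X + y - D.b - l • θ₁‖ ^ 2 + 1 / 2 * ‖D.C X + s - D.d - l • θ₂‖ ^ 2

/-- The objective `P` of the augmented Lagrangian subproblem. -/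
def penalized (l : ℝ) (θ₁ : EuclideanSpace ℝ (Fin q)) (θ₂ : EuclideanSpace ℝ (Fin p))
    (X : Matrix (Fin m) (Fin n) ℝ) (s : EuclideanSpace ℝ (Fin p))
    (y : EuclideanSpace ℝ (Fin q)) : ℝ :=
  l * (D.μ₁ * lrNorm D.α (singularVector X) + D.μ₂ * lrNorm D.β s)
    + D.smoothPart l θ₁ θ₂ X s y

/-- The set of values of `P` on the feasible set `{(X, s, y) : ‖y‖_γ ≤ ρ}` of the subproblem. -/
def penalizedValues (l : ℝ) (θ₁ : EuclideanSpace ℝ (Fin q)) (θ₂ : EuclideanSpace ℝ (Fin p)) :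
    Set ℝ :=
  {t | ∃ (X : Matrix (Fin m) (Fin n) ℝ) (s : EuclideanSpace ℝ (Fin p))
    (y : EuclideanSpace ℝ (Fin q)), lrNorm D.γ y ≤ D.ρ ∧ t = D.penalized l θ₁ θ₂ X s y}

/-- The partial gradient of `P` with respect to `y`. -/
def gradY (l : ℝ) (θ₁ : EuclideanSpace ℝ (Fin q)) (θ₂ : EuclideanSpace ℝ (Fin p))
    (X : Matrix (Fin m) (Fin n) ℝ) (s : EuclideanSpace ℝ (Fin p))
    (y : EuclideanSpace ℝ (Fin q)) : EuclideanSpace ℝ (Fin q) :=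
  gradient (fun y' => D.penalized l θ₁ θ₂ X s y') y

/-- The set of partial subgradients of `P` at `(X, s, y)` with respect to `(X, s)`. -/
def partialSubdiff (l : ℝ) (θ₁ : EuclideanSpace ℝ (Fin q)) (θ₂ : EuclideanSpace ℝ (Fin p))
    (X : Matrix (Fin m) (Fin n) ℝ) (s : EuclideanSpace ℝ (Fin p))
    (y : EuclideanSpace ℝ (Fin q)) :
    Set (Matrix (Fin m) (Fin n) ℝ × EuclideanSpace ℝ (Fin p)) :=
  {G | ∀ (X' : Matrix (Fin m) (Fin n) ℝ) (s' : EuclideanSpace ℝ (Fin p)),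
    D.penalized l θ₁ θ₂ X s y + frobInner G.1 (X' - X) + inner ℝ G.2 (s' - s)
      ≤ D.penalized l θ₁ θ₂ X' s' y}

/-- The first inner stopping condition: `ε`-optimality for the subproblem. -/
def StopA (l ε : ℝ) (θ₁ : EuclideanSpace ℝ (Fin q)) (θ₂ : EuclideanSpace ℝ (Fin p))
    (X : Matrix (Fin m) (Fin n) ℝ) (s : EuclideanSpace ℝ (Fin p))
    (y : EuclideanSpace ℝ (Fin q)) : Prop :=
  D.penalized l θ₁ θ₂ X s y ≤ sInf (D.penalizedValues l θ₁ θ₂) + ε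

/-- The second inner stopping condition, where `ηk` is the current bound on `μ₁ ‖σ(X)‖_α`. -/
def StopB (l τ ξ ηk : ℝ) (θ₁ : EuclideanSpace ℝ (Fin q)) (θ₂ : EuclideanSpace ℝ (Fin p))
    (X : Matrix (Fin m) (Fin n) ℝ) (s : EuclideanSpace ℝ (Fin p))
    (y : EuclideanSpace ℝ (Fin q)) : Prop :=
  (∃ G ∈ D.partialSubdiff l θ₁ θ₂ X s y, Real.sqrt (frobNorm G.1 ^ 2 + ‖G.2‖ ^ 2) ≤ τ) ∧
  D.ρ * dualNorm D.γ (D.gradY l θ₁ θ₂ X s y) + inner ℝ (D.gradY l θ₁ θ₂ X s y) y ≤ ξ ∧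
  D.μ₁ * lrNorm D.α (singularVector X) ≤ ηk

/-- The sequences `X, s, y` (with index `0` the starting point) and `θ₁, θ₂` (indices `k ≥ 1`) are
generated by FALC with parameters `lam, ε, τ, ξ` (indices `k ≥ 1`). -/
structure IsFALC (lam ε τ ξ : ℕ → ℝ) (X : ℕ → Matrix (Fin m) (Fin n) ℝ)
    (s : ℕ → EuclideanSpace ℝ (Fin p)) (y : ℕ → EuclideanSpace ℝ (Fin q))
    (θ₁ : ℕ → EuclideanSpace ℝ (Fin q)) (θ₂ : ℕ → EuclideanSpace ℝ (Fin p)) : Prop where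
  theta₁_one : θ₁ 1 = 0
  theta₂_one : θ₂ 1 = 0
  y_mem : ∀ k, 1 ≤ k → lrNorm D.γ (y k) ≤ D.ρ
  accept : ∀ k, 1 ≤ k →
    D.StopA (lam k) (ε k) (θ₁ k) (θ₂ k) (X k) (s k) (y k) ∨
    D.StopB (lam k) (τ k) (ξ k)
      (D.objective (X 0) + lam k / 2 * (‖θ₁ k‖ ^ 2 + ‖θ₂ k‖ ^ 2))
      (θ₁ k) (θ₂ k) (X k) (s k) (y k)
  theta₁_succ : ∀ k, 1 ≤ k →
    θ₁ (k + 1) = θ₁ k - (lam k)⁻¹ • (D.A (X k) + y k - D.b)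
  theta₂_succ : ∀ k, 1 ≤ k →
    θ₂ (k + 1) = θ₂ k - (lam k)⁻¹ • (D.C (X k) + s k - D.d)

end CompositeProblem

/-- The sequence `u 1, u 2, …` decreases monotonically to `0`. -/
def DecreasesToZero (u : ℕ → ℝ) : Prop :=
  AntitoneOn u (Ici 1) ∧ Tendsto u atTop (𝓝 0)

end

/-! Write w₁ = A X + y - b - λθ₁ and w₂ = C X + s - d - λθ₂ at an iterate, so that the multiplier
update reads λθ⁺ = -w. Everything comes from comparing the iterate with two kinds of test points of
the subproblem.

Residuals: with y fixed and M a right inverse of A, moving X by -M w₁ and s by C M w₁ - w₂ makes the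
smooth part vanish, while the norm terms grow by at most λK(‖w₁‖ + ‖w₂‖). Either stopping rule then
gives ½‖w‖² ≤ λK'(‖w₁‖ + ‖w₂‖) + Bλ², hence ‖w‖ = O(λ). So the multipliers stay bounded and the
constraint residuals are O(λ) (`exists_residual_le`, `IsFALC.exists_multiplier_bound`).

Objective: a feasible Y lifts to (Y, d - C Y, b - A Y), where the smooth part is only λ²/2 (‖θ₁‖² +
‖θ₂‖²). Comparing and dividing by λ bounds the split objective at the iterate by the objective of Y
plus o(1) plus τ/λ times the distance to the lift (`IsFALC.exists_estimate`). Along a convergent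
subsequence s and y converge too, and the limit is feasible and optimal. Boundedness comes from
coercivity of the norm carrying a positive weight.

Under rule (b) the argument needs ‖σ(·)‖ to be convex. Its triangle inequality is proved by testing
a matrix against singular vectors, which produces a doubly substochastic matrix. -/

noncomputable section

/-! ### Bessel families, a substitute for orthonormal systems. -/

section Bessel

variable {V : Type*} [NormedAddCommGroup V] [InnerProductSpace ℝ V] {ι : Type*} [Fintype ι]

/-- A finite family satisfying Bessel's inequality. -/
def IsBessel (u : ι → V) : Prop :=
  ∀ x, ∑ i, (inner ℝ (u i) x) ^ 2 ≤ ‖x‖ ^ 2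

theorem Orthonormal.isBessel {u : ι → V} (hu : Orthonormal ℝ u) : IsBessel u := by
  intro x
  simpa using hu.sum_inner_products_le x (s := Finset.univ)

theorem IsBessel.norm_le_one {u : ι → V} (hu : IsBessel u) (i : ι) : ‖u i‖ ≤ 1 := by
  have h1 : (inner ℝ (u i) (u i)) ^ 2 ≤ ‖u i‖ ^ 2 :=
    (Finset.single_le_sum (f := fun j => (inner ℝ (u j) (u i)) ^ 2)
      (fun j _ => sq_nonneg _) (Finset.mem_univ i)).trans (hu (u i))
  rw [real_inner_self_eq_norm_sq] at h1
  by_contra! h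
  nlinarith [sq_nonneg (‖u i‖), pow_lt_pow_left₀ h zero_le_one two_ne_zero]

/-- With z = ∑ ⟨uᵢ, x⟩ uᵢ and S = ∑ ⟨uᵢ, x⟩², one has ⟨x, z⟩ = S and ‖z‖² ≤ S, so 0 ≤ ‖x - z‖² ≤
‖x‖² - S. Some uᵢ may be zero. -/
theorem isBessel_of_inner_eq [DecidableEq ι] {u : ι → V} {w : ι → ℝ} (hw : ∀ i, w i ≤ 1)
    (hu : ∀ i j, inner ℝ (u i) (u j) = if i = j then w i else 0) : IsBessel u := by
  intro x
  set z := ∑ i, (inner ℝ (u i) x) • u i with hz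
  have h1 : inner ℝ x z = ∑ i, (inner ℝ (u i) x) ^ 2 := by
    simp only [hz, inner_sum, inner_smul_right, pow_two]
    exact Finset.sum_congr rfl fun i _ => by rw [real_inner_comm x (u i)]
  have h2 : ‖z‖ ^ 2 ≤ ∑ i, (inner ℝ (u i) x) ^ 2 := by
    rw [← real_inner_self_eq_norm_sq]
    simp only [hz, inner_sum, sum_inner, inner_smul_right, inner_smul_left, hu]
    refine Finset.sum_le_sum fun i _ => ?_
    simp
    nlinarith [hw i, sq_nonneg (inner ℝ (u i) x)]
  have h3 := norm_sub_sq_real x z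
  nlinarith [sq_nonneg ‖x - z‖]

theorem IsBessel.sum_abs_mul_abs_le {W : Type*} [NormedAddCommGroup W] [InnerProductSpace ℝ W]
    {u : ι → V} {v : ι → W} (hu : IsBessel u) (hv : IsBessel v) {x : V} {y : W}
    (hx : ‖x‖ ≤ 1) (hy : ‖y‖ ≤ 1) : ∑ i, |inner ℝ (u i) x| * |inner ℝ (v i) y| ≤ 1 := by
  have h : ∑ i, |inner ℝ (u i) x| * |inner ℝ (v i) y| ≤
      ∑ i, ((inner ℝ (u i) x) ^ 2 / 2 + (inner ℝ (v i) y) ^ 2 / 2) := by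
    refine Finset.sum_le_sum fun i _ => ?_
    nlinarith [sq_nonneg (|inner ℝ (u i) x| - |inner ℝ (v i) y|), sq_abs (inner ℝ (u i) x),
      sq_abs (inner ℝ (v i) y)]
  rw [Finset.sum_add_distrib, ← Finset.sum_div, ← Finset.sum_div] at h
  have h1 := hu x
  have h2 := hv y
  have h3 : ‖x‖ ^ 2 ≤ 1 := pow_le_one₀ (norm_nonneg _) hx
  have h4 : ‖y‖ ^ 2 ≤ 1 := pow_le_one₀ (norm_nonneg _) hy
  linarith

end Bessel

/-! ### Singular value decomposition. -/

section SVD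

variable {E F : Type*} [NormedAddCommGroup E] [InnerProductSpace ℝ E] [FiniteDimensional ℝ E]
  [NormedAddCommGroup F] [InnerProductSpace ℝ F] [FiniteDimensional ℝ F]

theorem LinearMap.exists_singularValue_decomposition (T : E →ₗ[ℝ] F) {m n : ℕ}
    (hn : Module.finrank ℝ E = n) (hm : Module.finrank ℝ F = m) :
    ∃ (u : Fin (min m n) → F) (v : Fin (min m n) → E), IsBessel u ∧ IsBessel v ∧
      (∀ x, T x = ∑ i : Fin (min m n), (T.singularValues i * inner ℝ (v i) x) • u i) ∧
      ∀ i, inner ℝ (u i) (T (v i)) = T.singularValues i := by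
  set e := T.isSymmetric_adjoint_comp_self.eigenvectorBasis hn with he
  have hinner : ∀ i j : Fin n, inner ℝ (T (e i)) (T (e j)) =
      if i = j then T.singularValues i ^ 2 else 0 := by
    intro i j
    rw [T.sq_singularValues_fin hn, ← LinearMap.adjoint_inner_left, ← LinearMap.comp_apply,
      T.isSymmetric_adjoint_comp_self.apply_eigenvectorBasis hn i]
    rw [inner_smul_left, orthonormal_iff_ite.mp e.orthonormal i j]
    split_ifs <;> simp
  have hzero : ∀ i : Fin n, T.singularValues i = 0 → T (e i) = 0 := by
    intro i hi
    rw [← inner_self_eq_zero (𝕜 := ℝ), hinner, if_pos rfl, hi]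
    simp
  let c : Fin (min m n) → Fin n := Fin.castLE (min_le_right m n)
  have hc : Function.Injective c := Fin.castLE_injective _
  have hcv : ∀ i, ((c i : Fin n) : ℕ) = i := fun i => rfl
  -- Since 0⁻¹ = 0, the left vector is zero when its singular value vanishes. The left family is
  -- therefore only Bessel, and no completion to an orthonormal one is needed.
  refine ⟨fun i => (T.singularValues i)⁻¹ • T (e (c i)), fun i => e (c i), ?_, ?_, ?_, ?_⟩
  · refine isBessel_of_inner_eq
      (w := fun i : Fin (min m n) => if T.singularValues i = 0 then 0 else 1) ?_ ?_
    · intro i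
      split_ifs <;> norm_num
    · intro i j
      rw [inner_smul_left, inner_smul_right, hinner, hcv]
      by_cases hij : i = j
      · subst hij
        by_cases h0 : T.singularValues i = 0
        · simp [h0]
        · simp only [if_true, if_neg h0]
          simp
          field_simp
      · rw [if_neg (fun h => hij (hc h)), if_neg hij]
        simp
  · exact (e.orthonormal.comp c hc).isBessel
  · intro x
    have hx : T x = ∑ j, inner ℝ (e j) x • T (e j) := by
      conv_lhs => rw [← e.sum_repr' x]
      simp
    rw [hx]
    symm
    refine Finset.sum_of_injOn c hc.injOn (by simp) ?_ ?_
    -- An index outside the image of `c` is at least m, hence at least the rank of T.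
    · intro j _ hj
      rw [hzero j, smul_zero]
      rw [LinearMap.singularValues_eq_zero_iff_le_finrank_range]
      refine (Submodule.finrank_le _).trans ?_
      rw [hm]
      by_contra! hlt
      exact hj ⟨⟨j, lt_min hlt j.2⟩, by simp, rfl⟩
    · intro i _
      by_cases h0 : T.singularValues i = 0
      · rw [hzero (c i) h0]
        simp [h0]
      · rw [smul_smul]
        congr 1
        field_simp
  · intro i
    rw [inner_smul_left, hinner, if_pos rfl, hcv]
    by_cases h0 : T.singularValues i = 0
    · simp [h0]
    · simp
      field_simp

end SVD

/-! ### The norms ℓ₁, ℓ₂, ℓ_∞ and substochastic matrices. -/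

section LrNorm

variable {k : ℕ}

theorem lrNorm_one (x : EuclideanSpace ℝ (Fin k)) : lrNorm 1 x = ∑ i, |x i| := by
  simp [lrNorm, PiLp.norm_eq_of_L1]

theorem lrNorm_two (x : EuclideanSpace ℝ (Fin k)) : lrNorm 2 x = √(∑ i, |x i| ^ 2) := by
  simp [lrNorm, PiLp.norm_eq_of_L2]

theorem lrNorm_top_le_iff {x : EuclideanSpace ℝ (Fin k)} {c : ℝ} (hc : 0 ≤ c) :
    lrNorm ∞ x ≤ c ↔ ∀ i, |x i| ≤ c := by
  rw [lrNorm, PiLp.norm_toLp, pi_norm_le_iff_of_nonneg hc]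
  rfl

/-- The `ℓ_r` norm as a seminorm on Euclidean space. -/
def lrSeminorm (k : ℕ) (r : ℝ≥0∞) [Fact (1 ≤ r)] : Seminorm ℝ (EuclideanSpace ℝ (Fin k)) :=
  Seminorm.of (lrNorm r)
    (fun x y => norm_add_le (WithLp.toLp r fun i => x i) (WithLp.toLp r fun i => y i))
    (fun a x => norm_smul a (WithLp.toLp r fun i => x i))

theorem lrSeminorm_apply (r : ℝ≥0∞) [Fact (1 ≤ r)] (x : EuclideanSpace ℝ (Fin k)) :
    lrSeminorm k r x = lrNorm r x := rfl

theorem abs_apply_le_lrNorm (r : ℝ≥0∞) [Fact (1 ≤ r)] (x : EuclideanSpace ℝ (Fin k))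
    (i : Fin k) : |x i| ≤ lrNorm r x :=
  PiLp.norm_apply_le (WithLp.toLp r fun i => x i) i

/-- A doubly substochastic matrix contracts the `ℓ₁`, `ℓ₂` and `ℓ_∞` norms. -/
theorem lrNorm_le_of_doubly_substochastic {l : ℕ} {r : ℝ≥0∞} (hr : r = 1 ∨ r = 2 ∨ r = ∞)
    {x : EuclideanSpace ℝ (Fin k)} {z : EuclideanSpace ℝ (Fin l)} {Q : Fin l → Fin k → ℝ}
    (hQ : ∀ i j, 0 ≤ Q i j) (hrow : ∀ i, ∑ j, Q i j ≤ 1) (hcol : ∀ j, ∑ i, Q i j ≤ 1)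
    (h : ∀ i, |z i| ≤ ∑ j, Q i j * |x j|) : lrNorm r z ≤ lrNorm r x := by
  rcases hr with rfl | rfl | rfl
  · rw [lrNorm_one, lrNorm_one]
    calc ∑ i, |z i| ≤ ∑ i, ∑ j, Q i j * |x j| := Finset.sum_le_sum fun i _ => h i
      _ = ∑ j, (∑ i, Q i j) * |x j| := by
        rw [Finset.sum_comm]
        exact Finset.sum_congr rfl fun j _ => by rw [Finset.sum_mul]
      _ ≤ ∑ j, |x j| := Finset.sum_le_sum fun j _ =>
        mul_le_of_le_one_left (abs_nonneg _) (hcol j)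
  · rw [lrNorm_two, lrNorm_two]
    refine Real.sqrt_le_sqrt ?_
    calc ∑ i, |z i| ^ 2 ≤ ∑ i, ∑ j, Q i j * |x j| ^ 2 := by
          refine Finset.sum_le_sum fun i _ => ?_
          -- Cauchy–Schwarz with weights Q i j.
          have h1 : (∑ j, Q i j * |x j|) ^ 2 ≤ (∑ j, Q i j) * ∑ j, Q i j * |x j| ^ 2 :=
            Finset.sum_sq_le_sum_mul_sum_of_sq_le_mul _ (fun j _ => hQ i j)
              (fun j _ => mul_nonneg (hQ i j) (sq_nonneg _)) (fun j _ => by ring_nf; rfl)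
          have h2 : 0 ≤ ∑ j, Q i j * |x j| ^ 2 :=
            Finset.sum_nonneg fun j _ => mul_nonneg (hQ i j) (sq_nonneg _)
          calc |z i| ^ 2 ≤ (∑ j, Q i j * |x j|) ^ 2 := pow_le_pow_left₀ (abs_nonneg _) (h i) 2
            _ ≤ _ := h1
            _ ≤ _ := mul_le_of_le_one_left h2 (hrow i)
      _ = ∑ j, (∑ i, Q i j) * |x j| ^ 2 := by
        rw [Finset.sum_comm]
        exact Finset.sum_congr rfl fun j _ => by rw [Finset.sum_mul]
      _ ≤ ∑ j, |x j| ^ 2 := Finset.sum_le_sum fun j _ =>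
        mul_le_of_le_one_left (sq_nonneg _) (hcol j)
  · have h0 : 0 ≤ lrNorm ∞ x := norm_nonneg _
    rw [lrNorm_top_le_iff h0]
    intro i
    calc |z i| ≤ ∑ j, Q i j * |x j| := h i
      _ ≤ ∑ j, Q i j * lrNorm ∞ x := Finset.sum_le_sum fun j _ =>
        mul_le_mul_of_nonneg_left (abs_apply_le_lrNorm ∞ x j) (hQ i j)
      _ = (∑ j, Q i j) * lrNorm ∞ x := by rw [Finset.sum_mul]
      _ ≤ lrNorm ∞ x := mul_le_of_le_one_left h0 (hrow i)

end LrNorm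

theorem fact_one_le_of_eq {r : ℝ≥0∞} (hr : r = 1 ∨ r = 2 ∨ r = ∞) : Fact (1 ≤ r) := by
  rcases hr with rfl | rfl | rfl <;> infer_instance

/-! ### Schatten norms of matrices. -/

section Schatten

variable {m n : ℕ}

theorem exists_svd (X : Matrix (Fin m) (Fin n) ℝ) :
    ∃ (u : Fin (min m n) → EuclideanSpace ℝ (Fin m)) (v : Fin (min m n) → EuclideanSpace ℝ (Fin n)),
      IsBessel u ∧ IsBessel v ∧
      (∀ x, Matrix.toEuclideanLin X x =
        ∑ i, (singularVector X i * inner ℝ (v i) x) • u i) ∧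
      ∀ i, inner ℝ (u i) (Matrix.toEuclideanLin X (v i)) = singularVector X i :=
  (Matrix.toEuclideanLin X).exists_singularValue_decomposition (by simp) (by simp)

/-- Testing a matrix against Bessel families gives a vector of norm at most that of the vector of
singular values. -/
theorem lrNorm_inner_le_lrNorm_singularVector {r : ℝ≥0∞} (hr : r = 1 ∨ r = 2 ∨ r = ∞)
    (X : Matrix (Fin m) (Fin n) ℝ) {l : ℕ} {a : Fin l → EuclideanSpace ℝ (Fin m)}
    {b : Fin l → EuclideanSpace ℝ (Fin n)} (ha : IsBessel a) (hb : IsBessel b) :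
    lrNorm r (WithLp.toLp 2 fun i => inner ℝ (a i) (Matrix.toEuclideanLin X (b i))) ≤
      lrNorm r (singularVector X) := by
  obtain ⟨u, v, hu, hv, hX, -⟩ := exists_svd X
  -- Expanding X gives ⟨aᵢ, X bᵢ⟩ = ∑ⱼ σⱼ ⟨aᵢ, uⱼ⟩⟨vⱼ, bᵢ⟩. Row sums of `Q` are at most 1 because u,
  -- v are Bessel, column sums because a, b are.
  refine lrNorm_le_of_doubly_substochastic hr
    (Q := fun i j => |inner ℝ (u j) (a i)| * |inner ℝ (v j) (b i)|)
    (fun i j => by positivity)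
    (fun i => hu.sum_abs_mul_abs_le hv (ha.norm_le_one i) (hb.norm_le_one i)) (fun j => ?_)
    (fun i => ?_)
  · simp only [real_inner_comm (a _) (u j), real_inner_comm (b _) (v j)]
    exact ha.sum_abs_mul_abs_le hb (hu.norm_le_one j) (hv.norm_le_one j)
  · simp only [hX, inner_sum, inner_smul_right]
    refine (Finset.abs_sum_le_sum_abs _ _).trans (le_of_eq ?_)
    refine Finset.sum_congr rfl fun j _ => ?_
    rw [abs_mul, abs_mul, real_inner_comm (a i) (u j)]
    ring

/-- The Schatten norm, the `ℓ_r` norm of the singular values, as a seminorm. -/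
def schattenSeminorm (m n : ℕ) {r : ℝ≥0∞} (hr : r = 1 ∨ r = 2 ∨ r = ∞) :
    Seminorm ℝ (Matrix (Fin m) (Fin n) ℝ) :=
  haveI := fact_one_le_of_eq hr
  Seminorm.ofSMulLE (fun X => lrNorm r (singularVector X))
    (by
      have : singularVector (0 : Matrix (Fin m) (Fin n) ℝ) = 0 := by
        ext i
        simp [singularVector]
      rw [this, ← lrSeminorm_apply, map_zero])
    (by
      intro X Y
      -- The singular vectors of the sum test X and Y separately; each test vector is dominated by
      -- the singular values of its matrix.
      obtain ⟨u, v, hu, hv, -, h⟩ := exists_svd (X + Y)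
      have hXY : singularVector (X + Y) =
          WithLp.toLp 2 (fun i => inner ℝ (u i) (Matrix.toEuclideanLin X (v i))) +
          WithLp.toLp 2 (fun i => inner ℝ (u i) (Matrix.toEuclideanLin Y (v i))) := by
        ext i
        rw [← h i]
        simp [inner_add_right]
      rw [hXY]
      exact (map_add_le_add (lrSeminorm _ r) _ _).trans
        (add_le_add (lrNorm_inner_le_lrNorm_singularVector hr X hu hv)
          (lrNorm_inner_le_lrNorm_singularVector hr Y hu hv)))
    (by
      intro c X
      obtain ⟨u, v, hu, hv, -, h⟩ := exists_svd (c • X)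
      have hX : singularVector (c • X) =
          c • WithLp.toLp 2 (fun i => inner ℝ (u i) (Matrix.toEuclideanLin X (v i))) := by
        ext i
        rw [← h i]
        simp [inner_smul_right]
      rw [hX, ← lrSeminorm_apply, map_smul_eq_mul]
      exact mul_le_mul_of_nonneg_left (lrNorm_inner_le_lrNorm_singularVector hr X hu hv)
        (norm_nonneg _))

theorem schattenSeminorm_apply {r : ℝ≥0∞} (hr : r = 1 ∨ r = 2 ∨ r = ∞)
    (X : Matrix (Fin m) (Fin n) ℝ) :
    schattenSeminorm m n hr X = lrNorm r (singularVector X) := rfl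

theorem frobInner_eq_sum (X Y : Matrix (Fin m) (Fin n) ℝ) :
    frobInner X Y = ∑ i, ∑ j, X i j * Y i j := by
  rw [frobInner, Matrix.trace, Finset.sum_comm]
  simp [Matrix.mul_apply]

theorem frobNorm_eq_sqrt (X : Matrix (Fin m) (Fin n) ℝ) :
    frobNorm X = √(∑ i, ∑ j, X i j ^ 2) := by
  simp only [frobNorm, frobInner_eq_sum, pow_two]

theorem abs_frobInner_le (X Y : Matrix (Fin m) (Fin n) ℝ) :
    |frobInner X Y| ≤ frobNorm X * frobNorm Y := by
  simp only [frobNorm_eq_sqrt, frobInner_eq_sum, ← Fintype.sum_prod_type']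
  rw [← Real.sqrt_mul (Finset.sum_nonneg fun _ _ => sq_nonneg _)]
  exact Real.abs_le_sqrt (Finset.sum_mul_sq_le_sq_mul_sq _ _ _)

theorem exists_frobNorm_le_schattenSeminorm (m n : ℕ) {r : ℝ≥0∞} (hr : r = 1 ∨ r = 2 ∨ r = ∞) :
    ∃ K : ℝ, 0 ≤ K ∧ ∀ X, frobNorm X ≤ K * schattenSeminorm m n hr X := by
  have := fact_one_le_of_eq hr
  refine ⟨√(m * n * (min m n : ℕ) ^ 2), Real.sqrt_nonneg _, fun X => ?_⟩
  set N := schattenSeminorm m n hr X with hN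
  have hN0 : 0 ≤ N := apply_nonneg _ _
  have hentry : ∀ i j, |X i j| ≤ (min m n : ℕ) * N := by
    intro i j
    obtain ⟨u, v, hu, hv, hX, -⟩ := exists_svd X
    have h1 : X i j = Matrix.toEuclideanLin X (EuclideanSpace.single j 1) i := by
      simp [Matrix.toLpLin_apply]
    rw [h1, hX, ← Real.norm_eq_abs]
    refine (PiLp.norm_apply_le (p := 2) _ i).trans ?_
    refine (norm_sum_le _ _).trans ?_
    refine (Finset.sum_le_card_nsmul _ _ N fun l _ => ?_).trans (by simp)
    rw [norm_smul, norm_mul]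
    have h2 : ‖inner ℝ (v l) (EuclideanSpace.single j (1 : ℝ))‖ ≤ 1 := by
      refine (norm_inner_le_norm _ _).trans ?_
      simpa using hv.norm_le_one l
    have h3 : ‖singularVector X l‖ ≤ N := abs_apply_le_lrNorm r (singularVector X) l
    calc _ ≤ N * 1 * 1 := by gcongr; exact hu.norm_le_one l
      _ = N := by ring
  rw [frobNorm_eq_sqrt, ← Real.sqrt_sq hN0, ← Real.sqrt_mul (by positivity)]
  refine Real.sqrt_le_sqrt ?_
  calc ∑ i, ∑ j, X i j ^ 2 ≤ ∑ i : Fin m, ∑ j : Fin n, ((min m n : ℕ) * N) ^ 2 := by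
        refine Finset.sum_le_sum fun i _ => Finset.sum_le_sum fun j _ => ?_
        exact sq_le_sq' (by linarith [neg_abs_le (X i j), hentry i j])
          (by linarith [le_abs_self (X i j), hentry i j])
    _ = _ := by simp; ring

end Schatten

/-! ### Finite-dimensional bounds, dual norms and scalar inequalities. -/

theorem Seminorm.continuous_of_finiteDimensional_real {E : Type*} [NormedAddCommGroup E]
    [NormedSpace ℝ E] [FiniteDimensional ℝ E] (p : Seminorm ℝ E) : Continuous p :=
  continuousOn_univ.mp (p.convexOn.continuousOn isOpen_univ)

theorem Seminorm.exists_le_mul_norm {E : Type*} [NormedAddCommGroup E]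
    [NormedSpace ℝ E] [FiniteDimensional ℝ E] (p : Seminorm ℝ E) :
    ∃ K : ℝ, 0 ≤ K ∧ ∀ x, p x ≤ K * ‖x‖ := by
  obtain ⟨K, hK, h⟩ := p.bound_of_continuous_normedSpace p.continuous_of_finiteDimensional_real
  exact ⟨K, hK.le, h⟩

theorem LinearMap.exists_norm_le_mul {E F : Type*} [NormedAddCommGroup E]
    [NormedSpace ℝ E] [FiniteDimensional ℝ E] [NormedAddCommGroup F] [NormedSpace ℝ F]
    (L : E →ₗ[ℝ] F) : ∃ K : ℝ, 0 ≤ K ∧ ∀ x, ‖L x‖ ≤ K * ‖x‖ :=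
  ((normSeminorm ℝ F).comp L).exists_le_mul_norm

theorem norm_le_sqrt_mul_lrNorm {k : ℕ} (r : ℝ≥0∞) [Fact (1 ≤ r)]
    (x : EuclideanSpace ℝ (Fin k)) : ‖x‖ ≤ √k * lrNorm r x := by
  have h0 : 0 ≤ lrNorm r x := apply_nonneg (lrSeminorm k r) x
  rw [EuclideanSpace.norm_eq, ← Real.sqrt_sq h0, ← Real.sqrt_mul (by positivity)]
  refine Real.sqrt_le_sqrt ((Finset.sum_le_card_nsmul _ _ (lrNorm r x ^ 2) fun i _ => ?_).trans
    (by simp))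
  exact pow_le_pow_left₀ (norm_nonneg _) (abs_apply_le_lrNorm r x i) 2

theorem inner_le_mul_dualNorm {k : ℕ} {r : ℝ≥0∞} [Fact (1 ≤ r)] {ρ : ℝ}
    {v w : EuclideanSpace ℝ (Fin k)} (hw : lrNorm r w ≤ ρ) :
    inner ℝ w v ≤ ρ * dualNorm r v := by
  have hρ : 0 ≤ ρ := (apply_nonneg (lrSeminorm k r) w).trans hw
  have heucl := norm_le_sqrt_mul_lrNorm (k := k) r
  -- For ρ = 0 the vector w vanishes; otherwise w/ρ competes in the supremum, which is finite by
  -- comparison with the Euclidean norm.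
  rcases hρ.eq_or_lt with rfl | hpos
  · have h1 := heucl w
    have h2 : ‖w‖ = 0 := by
      have : lrNorm r w = 0 := le_antisymm hw (apply_nonneg (lrSeminorm k r) w)
      rw [this, mul_zero] at h1
      exact le_antisymm h1 (norm_nonneg _)
    rw [norm_eq_zero.mp h2]
    simp
  · have hbdd : BddAbove {t : ℝ | ∃ w : EuclideanSpace ℝ (Fin k),
        lrNorm r w ≤ 1 ∧ t = inner ℝ w v} := by
      refine ⟨√k * ‖v‖, ?_⟩
      rintro t ⟨x, hx, rfl⟩
      refine (real_inner_le_norm _ _).trans (mul_le_mul_of_nonneg_right ?_ (norm_nonneg _))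
      exact (heucl x).trans (mul_le_of_le_one_right (Real.sqrt_nonneg _) hx)
    have h1 : inner ℝ (ρ⁻¹ • w) v ≤ dualNorm r v := by
      refine le_csSup hbdd ⟨ρ⁻¹ • w, ?_, rfl⟩
      rw [← lrSeminorm_apply, map_smul_eq_mul, lrSeminorm_apply, norm_inv, Real.norm_of_nonneg hρ]
      exact (inv_mul_le_one₀ hpos).mpr hw
    rw [inner_smul_left] at h1
    exact (inv_mul_le_iff₀ hpos).mp h1

theorem DecreasesToZero.nonneg {u : ℕ → ℝ} (hu : DecreasesToZero u) {k : ℕ} (hk : 1 ≤ k) :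
    0 ≤ u k := by
  refine le_of_tendsto hu.2 ?_
  filter_upwards [eventually_ge_atTop k] with j hj
  exact hu.1 hk (hk.trans hj) hj

/-- Divide by t and let t tend to 0. This extracts first-order conditions from inequalities along a
segment. -/
theorem le_of_forall_small_quadratic {a b c : ℝ}
    (h : ∀ t : ℝ, 0 < t → t ≤ 1 → t * a ≤ t * b + t ^ 2 * c) : a ≤ b := by
  by_contra! hab
  have hc : 0 < |c| + 1 := by positivity
  set t := min 1 ((a - b) / (2 * (|c| + 1))) with ht
  have ht0 : 0 < t := lt_min one_pos (div_pos (by linarith) (by linarith))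
  have h1 := h t ht0 (min_le_left _ _)
  have h2 : t * (2 * (|c| + 1)) ≤ a - b := by
    rw [← le_div_iff₀ (by linarith)]
    exact min_le_right _ _
  have h3 : t * a ≤ t * (b + t * c) := by linarith [show t * (b + t * c) = t * b + t ^ 2 * c by ring]
  have h4 : a ≤ b + t * c := le_of_mul_le_mul_left h3 ht0
  nlinarith [mul_le_mul_of_nonneg_left (le_abs_self c) ht0.le, mul_nonneg ht0.le (abs_nonneg c)]

/-- Complete the squares around l K; the constant is K plus a crude bound 2K + 2B + 2 for √(2K² +
2B). -/
theorem le_mul_of_sq_add_sq_le {a b l K B : ℝ} (hK : 0 ≤ K) (hB : 0 ≤ B)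
    (hl : 0 ≤ l) (h : 1 / 2 * a ^ 2 + 1 / 2 * b ^ 2 ≤ l * K * (a + b) + B * l ^ 2) :
    a ≤ l * (3 * K + 2 * B + 2) ∧ b ≤ l * (3 * K + 2 * B + 2) := by
  have h1 : (a - l * K) ^ 2 + (b - l * K) ^ 2 ≤ (l * (2 * K + 2 * B + 2)) ^ 2 := by
    have h2 : 0 ≤ l ^ 2 * (2 * K ^ 2 + 4 * B ^ 2 + 4 + 8 * K * B + 8 * K + 6 * B) := by positivity
    nlinarith
  have h0 : 0 ≤ l * (2 * K + 2 * B + 2) := by positivity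
  constructor
  · have := abs_le_of_sq_le_sq' (a := a - l * K) (by nlinarith [sq_nonneg (b - l * K)]) h0
    linarith [this.2]
  · have := abs_le_of_sq_le_sq' (a := b - l * K) (by nlinarith [sq_nonneg (a - l * K)]) h0
    linarith [this.2]

/-! ### Analysis of a single subproblem. -/

namespace CompositeProblem

variable {m n p q : ℕ} (D : CompositeProblem m n p q)

/-- The nonsmooth part of the objective after splitting off `s`. -/
def splitObjective (X : Matrix (Fin m) (Fin n) ℝ) (s : EuclideanSpace ℝ (Fin p)) : ℝ :=
  D.μ₁ * lrNorm D.α (singularVector X) + D.μ₂ * lrNorm D.β s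

theorem penalized_eq (l : ℝ) (θ₁ : EuclideanSpace ℝ (Fin q)) (θ₂ : EuclideanSpace ℝ (Fin p))
    (X : Matrix (Fin m) (Fin n) ℝ) (s : EuclideanSpace ℝ (Fin p))
    (y : EuclideanSpace ℝ (Fin q)) :
    D.penalized l θ₁ θ₂ X s y = l * D.splitObjective X s + D.smoothPart l θ₁ θ₂ X s y := rfl

theorem gradY_eq (l : ℝ) (θ₁ : EuclideanSpace ℝ (Fin q)) (θ₂ : EuclideanSpace ℝ (Fin p))
    (X : Matrix (Fin m) (Fin n) ℝ) (s : EuclideanSpace ℝ (Fin p))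
    (y : EuclideanSpace ℝ (Fin q)) :
    D.gradY l θ₁ θ₂ X s y = D.A X + y - D.b - l • θ₁ := by
  refine HasGradientAt.gradient ?_
  rw [hasGradientAt_iff_hasFDerivAt]
  have h1 : HasFDerivAt (fun y' : EuclideanSpace ℝ (Fin q) => D.A X + y' - D.b - l • θ₁)
      (ContinuousLinearMap.id ℝ _) y :=
    (((hasFDerivAt_id y).const_add _).sub_const _).sub_const _
  have h2 := ((h1.norm_sq.const_mul (1 / 2)).add_const
    (1 / 2 * ‖D.C X + s - D.d - l • θ₂‖ ^ 2)).const_add (l * D.splitObjective X s)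
  refine h2.congr_fderiv ?_
  ext w
  simp

variable {D}

theorem smoothPart_nonneg (l : ℝ) (θ₁ : EuclideanSpace ℝ (Fin q)) (θ₂ : EuclideanSpace ℝ (Fin p))
    (X : Matrix (Fin m) (Fin n) ℝ) (s : EuclideanSpace ℝ (Fin p))
    (y : EuclideanSpace ℝ (Fin q)) : 0 ≤ D.smoothPart l θ₁ θ₂ X s y := by
  unfold smoothPart
  positivity

theorem splitObjective_nonneg (hα : D.α = 1 ∨ D.α = 2 ∨ D.α = ∞)
    (hβ : D.β = 1 ∨ D.β = 2 ∨ D.β = ∞) (hμ₁ : 0 ≤ D.μ₁) (hμ₂ : 0 ≤ D.μ₂)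
    (X : Matrix (Fin m) (Fin n) ℝ) (s : EuclideanSpace ℝ (Fin p)) :
    0 ≤ D.splitObjective X s := by
  have := fact_one_le_of_eq hβ
  have h1 : 0 ≤ lrNorm D.α (singularVector X) := apply_nonneg (schattenSeminorm m n hα) X
  have h2 : 0 ≤ lrNorm D.β s := apply_nonneg (lrSeminorm p D.β) s
  unfold splitObjective
  positivity

theorem splitObjective_add_le (hα : D.α = 1 ∨ D.α = 2 ∨ D.α = ∞)
    (hβ : D.β = 1 ∨ D.β = 2 ∨ D.β = ∞) (hμ₁ : 0 ≤ D.μ₁) (hμ₂ : 0 ≤ D.μ₂)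
    (X Y : Matrix (Fin m) (Fin n) ℝ) (s t : EuclideanSpace ℝ (Fin p)) :
    D.splitObjective (X + Y) (s + t) ≤ D.splitObjective X s + D.splitObjective Y t := by
  have := fact_one_le_of_eq hβ
  have h1 := mul_le_mul_of_nonneg_left (map_add_le_add (schattenSeminorm m n hα) X Y) hμ₁
  have h2 := mul_le_mul_of_nonneg_left (map_add_le_add (lrSeminorm p D.β) s t) hμ₂
  simp only [schattenSeminorm_apply, lrSeminorm_apply] at h1 h2
  unfold splitObjective
  linarith

theorem splitObjective_smul (hα : D.α = 1 ∨ D.α = 2 ∨ D.α = ∞)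
    (hβ : D.β = 1 ∨ D.β = 2 ∨ D.β = ∞) {c : ℝ} (hc : 0 ≤ c)
    (X : Matrix (Fin m) (Fin n) ℝ) (s : EuclideanSpace ℝ (Fin p)) :
    D.splitObjective (c • X) (c • s) = c * D.splitObjective X s := by
  have := fact_one_le_of_eq hβ
  have h1 := map_smul_eq_mul (schattenSeminorm m n hα) c X
  have h2 := map_smul_eq_mul (lrSeminorm p D.β) c s
  simp only [schattenSeminorm_apply, lrSeminorm_apply, Real.norm_of_nonneg hc] at h1 h2
  unfold splitObjective
  rw [h1, h2]
  ring

theorem objective_eq_splitObjective (hβ : D.β = 1 ∨ D.β = 2 ∨ D.β = ∞)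
    (X : Matrix (Fin m) (Fin n) ℝ) : D.objective X = D.splitObjective X (D.d - D.C X) := by
  have := fact_one_le_of_eq hβ
  have h := map_sub_rev (lrSeminorm p D.β) (D.C X) D.d
  simp only [lrSeminorm_apply] at h
  rw [objective, splitObjective, h]

/-- At the lift of X both residuals vanish and only the multiplier terms remain. -/
theorem smoothPart_feasible (l : ℝ) (θ₁ : EuclideanSpace ℝ (Fin q))
    (θ₂ : EuclideanSpace ℝ (Fin p)) (X : Matrix (Fin m) (Fin n) ℝ) :
    D.smoothPart l θ₁ θ₂ X (D.d - D.C X) (D.b - D.A X) =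
      l ^ 2 / 2 * (‖θ₁‖ ^ 2 + ‖θ₂‖ ^ 2) := by
  have h1 : D.A X + (D.b - D.A X) - D.b - l • θ₁ = -(l • θ₁) := by abel
  have h2 : D.C X + (D.d - D.C X) - D.d - l • θ₂ = -(l • θ₂) := by abel
  rw [smoothPart, h1, h2, norm_neg, norm_neg, norm_smul, norm_smul, mul_pow, mul_pow,
    Real.norm_eq_abs, sq_abs]
  ring

theorem lrNorm_sub_le_of_mem_feasible (hγ : D.γ = 1 ∨ D.γ = 2 ∨ D.γ = ∞)
    {X : Matrix (Fin m) (Fin n) ℝ} (hX : X ∈ D.feasible) : lrNorm D.γ (D.b - D.A X) ≤ D.ρ := by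
  have := fact_one_le_of_eq hγ
  have h := map_sub_rev (lrSeminorm q D.γ) (D.A X) D.b
  simp only [lrSeminorm_apply] at h
  rw [← h]
  exact hX

variable {l ε τ ξ η : ℝ} {θ₁ : EuclideanSpace ℝ (Fin q)} {θ₂ : EuclideanSpace ℝ (Fin p)}
  {X : Matrix (Fin m) (Fin n) ℝ} {s : EuclideanSpace ℝ (Fin p)} {y : EuclideanSpace ℝ (Fin q)}

theorem StopA.penalized_le (hα : D.α = 1 ∨ D.α = 2 ∨ D.α = ∞)
    (hβ : D.β = 1 ∨ D.β = 2 ∨ D.β = ∞) (hμ₁ : 0 ≤ D.μ₁) (hμ₂ : 0 ≤ D.μ₂) (hl : 0 ≤ l)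
    (h : D.StopA l ε θ₁ θ₂ X s y) (X' : Matrix (Fin m) (Fin n) ℝ)
    (s' : EuclideanSpace ℝ (Fin p)) {y' : EuclideanSpace ℝ (Fin q)}
    (hy' : lrNorm D.γ y' ≤ D.ρ) :
    D.penalized l θ₁ θ₂ X s y ≤ D.penalized l θ₁ θ₂ X' s' y' + ε := by
  have hle : sInf (D.penalizedValues l θ₁ θ₂) ≤ D.penalized l θ₁ θ₂ X' s' y' :=
    csInf_le ⟨0, ?_⟩ ⟨X', s', y', hy', rfl⟩
  · exact h.trans (by linarith)
  rintro t ⟨X₀, s₀, y₀, -, rfl⟩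
  exact add_nonneg (mul_nonneg hl (splitObjective_nonneg hα hβ hμ₁ hμ₂ X₀ s₀))
    (smoothPart_nonneg _ _ _ _ _ _)

theorem StopA.splitObjective_le (hα : D.α = 1 ∨ D.α = 2 ∨ D.α = ∞)
    (hβ : D.β = 1 ∨ D.β = 2 ∨ D.β = ∞) (hγ : D.γ = 1 ∨ D.γ = 2 ∨ D.γ = ∞)
    (hμ₁ : 0 ≤ D.μ₁) (hμ₂ : 0 ≤ D.μ₂) (hl : 0 ≤ l)
    (h : D.StopA l ε θ₁ θ₂ X s y) {Y : Matrix (Fin m) (Fin n) ℝ} (hY : Y ∈ D.feasible) :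
    l * D.splitObjective X s ≤
      l * D.objective Y + l ^ 2 / 2 * (‖θ₁‖ ^ 2 + ‖θ₂‖ ^ 2) + ε := by
  have h1 := h.penalized_le hα hβ hμ₁ hμ₂ hl Y (D.d - D.C Y)
    (lrNorm_sub_le_of_mem_feasible hγ hY)
  rw [penalized_eq, penalized_eq, smoothPart_feasible, ← objective_eq_splitObjective hβ] at h1
  linarith [smoothPart_nonneg (D := D) l θ₁ θ₂ X s y]

/-- This is the subdifferential sum rule in the form needed: apply the subgradient inequality on the
segment towards (X', s'), use convexity of the norm terms, and drop the second-order part of the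
quadratic as t → 0. -/
theorem inner_le_of_mem_partialSubdiff (hα : D.α = 1 ∨ D.α = 2 ∨ D.α = ∞)
    (hβ : D.β = 1 ∨ D.β = 2 ∨ D.β = ∞) (hμ₁ : 0 ≤ D.μ₁) (hμ₂ : 0 ≤ D.μ₂) (hl : 0 ≤ l)
    {G : Matrix (Fin m) (Fin n) ℝ × EuclideanSpace ℝ (Fin p)}
    (hG : G ∈ D.partialSubdiff l θ₁ θ₂ X s y)
    (X' : Matrix (Fin m) (Fin n) ℝ) (s' : EuclideanSpace ℝ (Fin p)) :
    frobInner G.1 (X' - X) + inner ℝ G.2 (s' - s) ≤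
      l * (D.splitObjective X' s' - D.splitObjective X s) +
      inner ℝ (D.A X + y - D.b - l • θ₁) (D.A (X' - X)) +
      inner ℝ (D.C X + s - D.d - l • θ₂) (D.C (X' - X) + (s' - s)) := by
  set w₁ := D.A X + y - D.b - l • θ₁ with hw₁
  set w₂ := D.C X + s - D.d - l • θ₂ with hw₂
  refine le_of_forall_small_quadratic
    (c := 1 / 2 * ‖D.A (X' - X)‖ ^ 2 + 1 / 2 * ‖D.C (X' - X) + (s' - s)‖ ^ 2) fun t ht ht1 => ?_
  have h1 := hG (X + t • (X' - X)) (s + t • (s' - s))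
  rw [penalized_eq, penalized_eq] at h1
  have e1 : D.A (X + t • (X' - X)) + y - D.b - l • θ₁ = w₁ + t • D.A (X' - X) := by
    rw [map_add, map_smul, hw₁]
    abel
  have e2 : D.C (X + t • (X' - X)) + (s + t • (s' - s)) - D.d - l • θ₂ =
      w₂ + t • (D.C (X' - X) + (s' - s)) := by
    rw [map_add, map_smul, hw₂, smul_add]
    abel
  have h2 : D.splitObjective (X + t • (X' - X)) (s + t • (s' - s)) ≤
      (1 - t) * D.splitObjective X s + t * D.splitObjective X' s' := by
    have := splitObjective_add_le hα hβ hμ₁ hμ₂ ((1 - t) • X) (t • X') ((1 - t) • s) (t • s')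
    rw [splitObjective_smul hα hβ (by linarith), splitObjective_smul hα hβ ht.le] at this
    convert this using 2 <;> module
  rw [smoothPart, smoothPart, e1, e2, ← hw₁, ← hw₂, norm_add_sq_real w₁, norm_add_sq_real w₂,
    norm_smul, norm_smul, inner_smul_right, inner_smul_right, mul_pow, mul_pow,
    Real.norm_eq_abs, sq_abs, add_sub_cancel_left, add_sub_cancel_left, inner_smul_right] at h1
  have h3 : frobInner G.1 (t • (X' - X)) = t * frobInner G.1 (X' - X) := by
    simp [frobInner]
  rw [h3] at h1
  have h4 := mul_le_mul_of_nonneg_left h2 hl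
  linarith

theorem neg_le_frobInner_add_inner {G : Matrix (Fin m) (Fin n) ℝ × EuclideanSpace ℝ (Fin p)}
    (hG : √(frobNorm G.1 ^ 2 + ‖G.2‖ ^ 2) ≤ τ) (H : Matrix (Fin m) (Fin n) ℝ)
    (t : EuclideanSpace ℝ (Fin p)) :
    -(τ * (frobNorm H + ‖t‖)) ≤ frobInner G.1 H + inner ℝ G.2 t := by
  have h0 : ∀ Z : Matrix (Fin m) (Fin n) ℝ, 0 ≤ frobNorm Z := fun Z => Real.sqrt_nonneg _
  have h1 : frobNorm G.1 ≤ τ :=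
    (Real.le_sqrt_of_sq_le (by linarith [sq_nonneg ‖G.2‖])).trans hG
  have h2 : ‖G.2‖ ≤ τ :=
    (Real.le_sqrt_of_sq_le (by linarith [sq_nonneg (frobNorm G.1)])).trans hG
  have h3 := (abs_le.mp (abs_frobInner_le G.1 H)).1
  have h4 := (abs_le.mp (abs_real_inner_le_norm G.2 t)).1
  have h5 := mul_le_mul_of_nonneg_right h1 (h0 H)
  have h6 := mul_le_mul_of_nonneg_right h2 (norm_nonneg t)
  linarith

/-- The smooth part lies above its linearization at the iterate. Towards the lift of Y, the (X, s)
part of the linear term is controlled by the small subgradient, and the y part by the dual norm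
condition, which bounds it below by -ξ on the ball. -/
theorem StopB.splitObjective_le (hα : D.α = 1 ∨ D.α = 2 ∨ D.α = ∞)
    (hβ : D.β = 1 ∨ D.β = 2 ∨ D.β = ∞) (hγ : D.γ = 1 ∨ D.γ = 2 ∨ D.γ = ∞)
    (hμ₁ : 0 ≤ D.μ₁) (hμ₂ : 0 ≤ D.μ₂) (hl : 0 ≤ l)
    (h : D.StopB l τ ξ η θ₁ θ₂ X s y) {Y : Matrix (Fin m) (Fin n) ℝ} (hY : Y ∈ D.feasible) :
    l * D.splitObjective X s ≤
      l * D.objective Y + l ^ 2 / 2 * (‖θ₁‖ ^ 2 + ‖θ₂‖ ^ 2) + ξ +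
        τ * (frobNorm (Y - X) + ‖D.d - D.C Y - s‖) := by
  have := fact_one_le_of_eq hγ
  obtain ⟨⟨G, hG, hGτ⟩, hy, -⟩ := h
  have h1 := inner_le_of_mem_partialSubdiff hα hβ hμ₁ hμ₂ hl hG Y (D.d - D.C Y)
  have h2 := neg_le_frobInner_add_inner hGτ (Y - X) (D.d - D.C Y - s)
  rw [gradY_eq] at hy
  set w₁ := D.A X + y - D.b - l • θ₁ with hw₁
  set w₂ := D.C X + s - D.d - l • θ₂ with hw₂
  have h3 : inner ℝ (-(D.b - D.A Y)) w₁ ≤ D.ρ * dualNorm D.γ w₁ := by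
    refine inner_le_mul_dualNorm ?_
    rw [← lrSeminorm_apply, map_neg_eq_map]
    exact lrNorm_sub_le_of_mem_feasible hγ hY
  have h4 := smoothPart_feasible (D := D) l θ₁ θ₂ Y
  have e1 : D.A Y + (D.b - D.A Y) - D.b - l • θ₁ =
      w₁ + (D.A (Y - X) + (D.b - D.A Y - y)) := by
    rw [map_sub, hw₁]
    abel
  have e2 : D.C Y + (D.d - D.C Y) - D.d - l • θ₂ =
      w₂ + (D.C (Y - X) + (D.d - D.C Y - s)) := by
    rw [map_sub, hw₂]
    abel
  rw [smoothPart, e1, e2, norm_add_sq_real w₁, norm_add_sq_real w₂, inner_add_right w₁] at h4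
  rw [inner_neg_left, real_inner_comm] at h3
  have h5 : inner ℝ w₁ (D.b - D.A Y - y) = inner ℝ w₁ (D.b - D.A Y) - inner ℝ w₁ y :=
    inner_sub_right _ _ _
  rw [objective_eq_splitObjective hβ]
  nlinarith [sq_nonneg ‖w₁‖, sq_nonneg ‖w₂‖, sq_nonneg ‖D.A (Y - X) + (D.b - D.A Y - y)‖,
    sq_nonneg ‖D.C (Y - X) + (D.d - D.C Y - s)‖]

section Frobenius

attribute [local instance] Matrix.frobeniusNormedAddCommGroup Matrix.frobeniusNormedSpace

theorem frobNorm_eq_norm (X : Matrix (Fin m) (Fin n) ℝ) : frobNorm X = ‖X‖ := by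
  rw [Matrix.frobenius_norm_def, frobNorm_eq_sqrt, Real.sqrt_eq_rpow]
  simp

/-- An approximate stationarity certificate bounds the residuals by a multiple of the penalty. -/
theorem exists_residual_le (hα : D.α = 1 ∨ D.α = 2 ∨ D.α = ∞)
    (hβ : D.β = 1 ∨ D.β = 2 ∨ D.β = ∞) (hμ₁ : 0 ≤ D.μ₁) (hμ₂ : 0 ≤ D.μ₂)
    (hA : Function.Surjective D.A) {B T : ℝ} (hB : 0 ≤ B) (hT : 0 ≤ T) :
    ∃ K : ℝ, 0 ≤ K ∧ ∀ (l ε τ : ℝ) (θ₁ : EuclideanSpace ℝ (Fin q))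
      (θ₂ : EuclideanSpace ℝ (Fin p)) (X : Matrix (Fin m) (Fin n) ℝ)
      (s : EuclideanSpace ℝ (Fin p)) (y : EuclideanSpace ℝ (Fin q)),
      0 ≤ l → ε ≤ B * l ^ 2 → τ ≤ T * l →
      (∀ X' s', D.penalized l θ₁ θ₂ X s y ≤
        D.penalized l θ₁ θ₂ X' s' y + ε + τ * (‖X' - X‖ + ‖s' - s‖)) →
      ‖D.A X + y - D.b - l • θ₁‖ ≤ l * K ∧ ‖D.C X + s - D.d - l • θ₂‖ ≤ l * K := by
  have := fact_one_le_of_eq hβ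
  obtain ⟨M, hM⟩ := D.A.exists_rightInverse_of_surjective (LinearMap.range_eq_top.mpr hA)
  obtain ⟨a, ha, hMa⟩ := M.exists_norm_le_mul
  obtain ⟨c, hc, hCc⟩ := D.C.exists_norm_le_mul
  obtain ⟨r, hr, hNr⟩ := (schattenSeminorm m n hα).exists_le_mul_norm
  obtain ⟨e, he, hSe⟩ := (lrSeminorm p D.β).exists_le_mul_norm
  set K₁ := D.μ₁ * (r * a) + D.μ₂ * (e * (c * a + 1)) with hK₁
  set K₂ := a + (c * a + 1) with hK₂
  refine ⟨3 * (K₁ + T * K₂) + 2 * B + 2, by positivity, ?_⟩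
  intro l ε τ θ₁ θ₂ X s y hl hε hτ h
  set w₁ := D.A X + y - D.b - l • θ₁ with hw₁
  set w₂ := D.C X + s - D.d - l • θ₂ with hw₂
  have hAM : ∀ w, D.A (M w) = w := fun w => LinearMap.congr_fun hM w
  -- This test point annihilates both residuals without moving y.
  have h1 := h (X + -M w₁) (s + (D.C (M w₁) - w₂))
  have hf : D.smoothPart l θ₁ θ₂ (X + -M w₁) (s + (D.C (M w₁) - w₂)) y = 0 := by
    have e1 : D.A (X + -M w₁) + y - D.b - l • θ₁ = 0 := by
      rw [map_add, map_neg, hAM, hw₁]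
      abel
    have e2 : D.C (X + -M w₁) + (s + (D.C (M w₁) - w₂)) - D.d - l • θ₂ = 0 := by
      rw [map_add, map_neg, hw₂]
      abel
    rw [smoothPart, e1, e2]
    simp
  have hn₁ : ‖-M w₁‖ ≤ a * (‖w₁‖ + ‖w₂‖) := by
    rw [norm_neg]
    exact (hMa w₁).trans (mul_le_mul_of_nonneg_left (by linarith [norm_nonneg w₂]) ha)
  have hn₂ : ‖D.C (M w₁) - w₂‖ ≤ (c * a + 1) * (‖w₁‖ + ‖w₂‖) := by
    have h2 := mul_le_mul_of_nonneg_left (hMa w₁) hc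
    have h3 := norm_sub_le (D.C (M w₁)) w₂
    nlinarith [hCc (M w₁), norm_nonneg w₁, norm_nonneg w₂,
      mul_nonneg (mul_nonneg hc ha) (norm_nonneg w₂)]
  have hs : D.splitObjective (X + -M w₁) (s + (D.C (M w₁) - w₂)) ≤
      D.splitObjective X s + K₁ * (‖w₁‖ + ‖w₂‖) := by
    refine (splitObjective_add_le hα hβ hμ₁ hμ₂ _ _ _ _).trans ?_
    have h2 : lrNorm D.α (singularVector (-M w₁)) ≤ r * (a * (‖w₁‖ + ‖w₂‖)) :=
      (hNr _).trans (mul_le_mul_of_nonneg_left hn₁ hr)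
    have h3 : lrNorm D.β (D.C (M w₁) - w₂) ≤ e * ((c * a + 1) * (‖w₁‖ + ‖w₂‖)) :=
      (hSe _).trans (mul_le_mul_of_nonneg_left hn₂ he)
    have h4 := mul_le_mul_of_nonneg_left h2 hμ₁
    have h5 := mul_le_mul_of_nonneg_left h3 hμ₂
    rw [add_le_add_iff_left, splitObjective, hK₁]
    linarith
  rw [penalized_eq, penalized_eq, hf, add_sub_cancel_left, add_sub_cancel_left, smoothPart,
    ← hw₁, ← hw₂] at h1
  have h2 := mul_le_mul_of_nonneg_left hs hl
  have h3 : τ * (‖-M w₁‖ + ‖D.C (M w₁) - w₂‖) ≤ T * l * (K₂ * (‖w₁‖ + ‖w₂‖)) := by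
    have h4 : ‖-M w₁‖ + ‖D.C (M w₁) - w₂‖ ≤ K₂ * (‖w₁‖ + ‖w₂‖) := by
      rw [hK₂]
      linarith
    exact (mul_le_mul_of_nonneg_right hτ (by positivity)).trans
      (mul_le_mul_of_nonneg_left h4 (by positivity))
  exact le_mul_of_sq_add_sq_le (by positivity) hB hl (by linarith)

end Frobenius

end CompositeProblem

/-! ### Analysis of a whole run. -/

theorem exists_bound_of_eventually_le {u : ℕ → ℝ} {R : ℝ} (h : ∀ᶠ k in atTop, u k ≤ R) :
    ∃ R', ∀ k, u k ≤ R' := by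
  obtain ⟨N, hN⟩ := eventually_atTop.mp h
  obtain ⟨S, hS⟩ := ((finite_lt_nat N).image u).bddAbove
  refine ⟨max R S, fun k => ?_⟩
  rcases lt_or_ge k N with hk | hk
  · exact (hS ⟨k, hk, rfl⟩).trans (le_max_right _ _)
  · exact (hN k hk).trans (le_max_left _ _)

namespace CompositeProblem

variable {m n p q : ℕ} {D : CompositeProblem m n p q}

section Frobenius

attribute [local instance] Matrix.frobeniusNormedAddCommGroup Matrix.frobeniusNormedSpace

theorem tendsto_splitObjective (hα : D.α = 1 ∨ D.α = 2 ∨ D.α = ∞)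
    (hβ : D.β = 1 ∨ D.β = 2 ∨ D.β = ∞) {ι : Type*} {f : Filter ι}
    {X : ι → Matrix (Fin m) (Fin n) ℝ} {s : ι → EuclideanSpace ℝ (Fin p)}
    {X₀ : Matrix (Fin m) (Fin n) ℝ} {s₀ : EuclideanSpace ℝ (Fin p)}
    (hX : Tendsto X f (𝓝 X₀)) (hs : Tendsto s f (𝓝 s₀)) :
    Tendsto (fun j => D.splitObjective (X j) (s j)) f (𝓝 (D.splitObjective X₀ s₀)) := by
  have := fact_one_le_of_eq hβ
  have h1 : Tendsto (fun j => schattenSeminorm m n hα (X j)) f (𝓝 (schattenSeminorm m n hα X₀)) :=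
    ((schattenSeminorm m n hα).continuous_of_finiteDimensional_real.tendsto X₀).comp hX
  have h2 : Tendsto (fun j => lrSeminorm p D.β (s j)) f (𝓝 (lrSeminorm p D.β s₀)) :=
    ((lrSeminorm p D.β).continuous_of_finiteDimensional_real.tendsto s₀).comp hs
  exact (h1.const_mul D.μ₁).add (h2.const_mul D.μ₂)

variable {lam ε τ ξ : ℕ → ℝ} {X : ℕ → Matrix (Fin m) (Fin n) ℝ}
    {s : ℕ → EuclideanSpace ℝ (Fin p)} {y : ℕ → EuclideanSpace ℝ (Fin q)}
    {θ₁ : ℕ → EuclideanSpace ℝ (Fin q)} {θ₂ : ℕ → EuclideanSpace ℝ (Fin p)}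

theorem feasible_nonempty (hγ : D.γ = 1 ∨ D.γ = 2 ∨ D.γ = ∞) (hρ : 0 ≤ D.ρ)
    (hA : Function.Surjective D.A) : D.feasible.Nonempty := by
  have := fact_one_le_of_eq hγ
  obtain ⟨Y, hY⟩ := hA D.b
  refine ⟨Y, ?_⟩
  rw [feasible, mem_ofPred_eq, hY, sub_self, ← lrSeminorm_apply, map_zero]
  exact hρ

/-- Along a run the multipliers are bounded and the residuals are of the order of the penalty. -/
theorem IsFALC.exists_multiplier_bound (hrun : D.IsFALC lam ε τ ξ X s y θ₁ θ₂)
    (hα : D.α = 1 ∨ D.α = 2 ∨ D.α = ∞) (hβ : D.β = 1 ∨ D.β = 2 ∨ D.β = ∞)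
    (hμ₁ : 0 ≤ D.μ₁) (hμ₂ : 0 ≤ D.μ₂) (hA : Function.Surjective D.A)
    (hlam_pos : ∀ k, 1 ≤ k → 0 < lam k) (hε : ∀ k, 1 ≤ k → 0 ≤ ε k)
    (hτ : ∀ k, 1 ≤ k → 0 ≤ τ k) {B T : ℝ} (hB : 0 ≤ B) (hT : 0 ≤ T)
    (hεlam : ∀ k, 1 ≤ k → ε k ≤ B * lam k ^ 2) (hτlam : ∀ k, 1 ≤ k → τ k ≤ T * lam k) :
    ∃ K : ℝ, 0 ≤ K ∧ ∀ k, 1 ≤ k → ‖θ₁ k‖ ≤ K ∧ ‖θ₂ k‖ ≤ K ∧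
      ‖D.A (X k) + y k - D.b‖ ≤ 2 * K * lam k ∧ ‖D.C (X k) + s k - D.d‖ ≤ 2 * K * lam k := by
  obtain ⟨K, hK, h⟩ := exists_residual_le hα hβ hμ₁ hμ₂ hA hB hT
  have hθ : ∀ k, 1 ≤ k → ‖D.A (X k) + y k - D.b - lam k • θ₁ k‖ ≤ lam k * K ∧
      ‖D.C (X k) + s k - D.d - lam k • θ₂ k‖ ≤ lam k * K := by
    intro k hk
    refine h _ _ _ _ _ _ _ _ (hlam_pos k hk).le (hεlam k hk) (hτlam k hk) fun X' s' => ?_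
    -- Rule (a) yields the ε error and rule (b) the τ error; one inequality carrying both covers
    -- either case.
    rcases hrun.accept k hk with hacc | ⟨⟨G, hG, hGτ⟩, -, -⟩
    · have h1 := hacc.penalized_le hα hβ hμ₁ hμ₂ (hlam_pos k hk).le X' s' (hrun.y_mem k hk)
      have h2 : 0 ≤ τ k * (‖X' - X k‖ + ‖s' - s k‖) := mul_nonneg (hτ k hk) (by positivity)
      linarith
    · have h1 := hG X' s'
      have h2 := neg_le_frobInner_add_inner hGτ (X' - X k) (s' - s k)
      rw [frobNorm_eq_norm] at h2
      linarith [hε k hk]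
  have hrec₁ : ∀ k, 1 ≤ k → lam k • θ₁ (k + 1) = -(D.A (X k) + y k - D.b - lam k • θ₁ k) := by
    intro k hk
    rw [hrun.theta₁_succ k hk, smul_sub, smul_inv_smul₀ (hlam_pos k hk).ne']
    abel
  have hrec₂ : ∀ k, 1 ≤ k → lam k • θ₂ (k + 1) = -(D.C (X k) + s k - D.d - lam k • θ₂ k) := by
    intro k hk
    rw [hrun.theta₂_succ k hk, smul_sub, smul_inv_smul₀ (hlam_pos k hk).ne']
    abel
  have hsucc : ∀ k, 1 ≤ k → ‖θ₁ (k + 1)‖ ≤ K ∧ ‖θ₂ (k + 1)‖ ≤ K := by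
    intro k hk
    have hl := hlam_pos k hk
    have h1 := congrArg norm (hrec₁ k hk)
    have h2 := congrArg norm (hrec₂ k hk)
    rw [norm_smul, norm_neg, Real.norm_of_nonneg hl.le] at h1 h2
    exact ⟨le_of_mul_le_mul_left (h1.le.trans (hθ k hk).1) hl,
      le_of_mul_le_mul_left (h2.le.trans (hθ k hk).2) hl⟩
  have hall : ∀ k, 1 ≤ k → ‖θ₁ k‖ ≤ K ∧ ‖θ₂ k‖ ≤ K := by
    intro k hk
    rcases hk.eq_or_lt with rfl | hk
    · rw [hrun.theta₁_one, hrun.theta₂_one, norm_zero, norm_zero]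
      exact ⟨hK, hK⟩
    · obtain ⟨j, rfl⟩ := Nat.exists_eq_add_of_lt hk
      exact hsucc (1 + j) (by omega)
  refine ⟨K, hK, fun k hk => ⟨(hall k hk).1, (hall k hk).2, ?_, ?_⟩⟩
  · have h1 := norm_add_le (D.A (X k) + y k - D.b - lam k • θ₁ k) (lam k • θ₁ k)
    rw [sub_add_cancel, norm_smul, Real.norm_of_nonneg (hlam_pos k hk).le] at h1
    have h2 := mul_le_mul_of_nonneg_left (hall k hk).1 (hlam_pos k hk).le
    linarith [(hθ k hk).1]
  · have h1 := norm_add_le (D.C (X k) + s k - D.d - lam k • θ₂ k) (lam k • θ₂ k)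
    rw [sub_add_cancel, norm_smul, Real.norm_of_nonneg (hlam_pos k hk).le] at h1
    have h2 := mul_le_mul_of_nonneg_left (hall k hk).2 (hlam_pos k hk).le
    linarith [(hθ k hk).2]

theorem sq_mul_sq_add_sq_le {l K a b : ℝ} (ha0 : 0 ≤ a) (hb0 : 0 ≤ b) (ha : a ≤ K) (hb : b ≤ K) :
    l ^ 2 / 2 * (a ^ 2 + b ^ 2) ≤ l * (l * K ^ 2) := by
  have h1 := pow_le_pow_left₀ ha0 ha 2
  have h2 := pow_le_pow_left₀ hb0 hb 2
  nlinarith [mul_nonneg (sq_nonneg l) (sub_nonneg.mpr h1),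
    mul_nonneg (sq_nonneg l) (sub_nonneg.mpr h2)]

/-- The objective along a run exceeds the optimal value by at most a vanishing error. -/
theorem IsFALC.exists_estimate (hrun : D.IsFALC lam ε τ ξ X s y θ₁ θ₂)
    (hα : D.α = 1 ∨ D.α = 2 ∨ D.α = ∞) (hβ : D.β = 1 ∨ D.β = 2 ∨ D.β = ∞)
    (hγ : D.γ = 1 ∨ D.γ = 2 ∨ D.γ = ∞)
    (hμ₁ : 0 ≤ D.μ₁) (hμ₂ : 0 ≤ D.μ₂) (hA : Function.Surjective D.A)
    (hlam_pos : ∀ k, 1 ≤ k → 0 < lam k) (hlam : Tendsto lam atTop (𝓝 0))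
    (hε : ∀ k, 1 ≤ k → 0 ≤ ε k) (hτ : ∀ k, 1 ≤ k → 0 ≤ τ k) (hξ : ∀ k, 1 ≤ k → 0 ≤ ξ k)
    (hεlam : ∃ B : ℝ, 0 < B ∧ ∀ k, 1 ≤ k → ε k / lam k ^ 2 ≤ B)
    (hτlam : Tendsto (fun k => τ k / lam k) atTop (𝓝 0))
    (hξlam : Tendsto (fun k => ξ k / lam k) atTop (𝓝 0)) :
    ∃ (K : ℝ) (e : ℕ → ℝ), 0 ≤ K ∧ Tendsto e atTop (𝓝 0) ∧
      (∀ k, 1 ≤ k → ‖θ₁ k‖ ≤ K ∧ ‖θ₂ k‖ ≤ K ∧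
        ‖D.A (X k) + y k - D.b‖ ≤ 2 * K * lam k ∧ ‖D.C (X k) + s k - D.d‖ ≤ 2 * K * lam k) ∧
      (∀ k, 1 ≤ k → ∀ Y ∈ D.feasible,
        D.StopA (lam k) (ε k) (θ₁ k) (θ₂ k) (X k) (s k) (y k) →
        D.splitObjective (X k) (s k) ≤ D.objective Y + e k) ∧
      ∀ k, 1 ≤ k → ∀ Y ∈ D.feasible, D.splitObjective (X k) (s k) ≤
        D.objective Y + e k + τ k / lam k * (‖Y - X k‖ + ‖D.d - D.C Y - s k‖) := by
  obtain ⟨B, hB, hεB⟩ := hεlam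
  have hεB' : ∀ k, 1 ≤ k → ε k ≤ B * lam k ^ 2 := fun k hk =>
    (div_le_iff₀ (pow_pos (hlam_pos k hk) 2)).mp (hεB k hk)
  obtain ⟨T, hTb⟩ := exists_bound_of_eventually_le (hτlam.eventually_le_const one_pos)
  obtain ⟨K, hK, hbd⟩ := hrun.exists_multiplier_bound hα hβ hμ₁ hμ₂ hA hlam_pos hε hτ hB.le
    (le_max_right T 0) hεB' fun k hk =>
      (div_le_iff₀ (hlam_pos k hk)).mp ((hTb k).trans (le_max_left T 0))
  -- The three terms come, after division by λ, from the multipliers, from ε ≤ Bλ², and from ξ.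
  set e : ℕ → ℝ := fun k => lam k * K ^ 2 + lam k * B + ξ k / lam k with he
  have he0 : Tendsto e atTop (𝓝 0) := by
    simpa using ((hlam.mul_const (K ^ 2)).add (hlam.mul_const B)).add hξlam
  -- Under rule (a) no distance term appears, so this bound is usable before the iterates are known
  -- to be bounded.
  have hlow : ∀ k, 1 ≤ k → ∀ Y ∈ D.feasible,
      D.StopA (lam k) (ε k) (θ₁ k) (θ₂ k) (X k) (s k) (y k) →
      D.splitObjective (X k) (s k) ≤ D.objective Y + e k := by
    intro k hk Y hY hacc
    have hl := hlam_pos k hk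
    refine le_of_mul_le_mul_left ?_ hl
    have h1 := hacc.splitObjective_le hα hβ hγ hμ₁ hμ₂ hl.le hY
    have h2 := sq_mul_sq_add_sq_le (l := lam k) (norm_nonneg (θ₁ k)) (norm_nonneg (θ₂ k))
      (hbd k hk).1 (hbd k hk).2.1
    have h3 : lam k * (ξ k / lam k) = ξ k := mul_div_cancel₀ _ hl.ne'
    simp only [he, mul_add]
    linarith [hεB' k hk, hξ k hk]
  have hkey : ∀ k, 1 ≤ k → ∀ Y ∈ D.feasible, D.splitObjective (X k) (s k) ≤
      D.objective Y + e k + τ k / lam k * (‖Y - X k‖ + ‖D.d - D.C Y - s k‖) := by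
    intro k hk Y hY
    have hl := hlam_pos k hk
    rcases hrun.accept k hk with hacc | hacc
    · have h1 : 0 ≤ τ k / lam k * (‖Y - X k‖ + ‖D.d - D.C Y - s k‖) :=
        mul_nonneg (div_nonneg (hτ k hk) hl.le) (by positivity)
      linarith [hlow k hk Y hY hacc]
    · refine le_of_mul_le_mul_left ?_ hl
      have h1 := hacc.splitObjective_le hα hβ hγ hμ₁ hμ₂ hl.le hY
      have h2 := sq_mul_sq_add_sq_le (l := lam k) (norm_nonneg (θ₁ k)) (norm_nonneg (θ₂ k))
        (hbd k hk).1 (hbd k hk).2.1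
      have h3 : lam k * (ξ k / lam k) = ξ k := mul_div_cancel₀ _ hl.ne'
      have h4 : lam k * (τ k / lam k * (‖Y - X k‖ + ‖D.d - D.C Y - s k‖)) =
          τ k * (‖Y - X k‖ + ‖D.d - D.C Y - s k‖) := by
        rw [← mul_assoc, mul_div_cancel₀ _ hl.ne']
      rw [frobNorm_eq_norm] at h1
      have h5 : 0 ≤ lam k * (lam k * B) := by positivity
      simp only [he, mul_add] at h4 ⊢
      linarith
  exact ⟨K, e, hK, he0, hbd, hlow, hkey⟩

theorem IsFALC.exists_norm_le (hrun : D.IsFALC lam ε τ ξ X s y θ₁ θ₂)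
    (hα : D.α = 1 ∨ D.α = 2 ∨ D.α = ∞) (hβ : D.β = 1 ∨ D.β = 2 ∨ D.β = ∞)
    (hγ : D.γ = 1 ∨ D.γ = 2 ∨ D.γ = ∞)
    (hμ₁ : 0 ≤ D.μ₁) (hμ₂ : 0 ≤ D.μ₂) (hρ : 0 ≤ D.ρ) (hA : Function.Surjective D.A)
    (hlam_pos : ∀ k, 1 ≤ k → 0 < lam k) (hlam : Tendsto lam atTop (𝓝 0))
    (hε : ∀ k, 1 ≤ k → 0 ≤ ε k) (hτ : ∀ k, 1 ≤ k → 0 ≤ τ k) (hξ : ∀ k, 1 ≤ k → 0 ≤ ξ k)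
    (hεlam : ∃ B : ℝ, 0 < B ∧ ∀ k, 1 ≤ k → ε k / lam k ^ 2 ≤ B)
    (hτlam : Tendsto (fun k => τ k / lam k) atTop (𝓝 0))
    (hξlam : Tendsto (fun k => ξ k / lam k) atTop (𝓝 0))
    (hpos : 0 < D.μ₁ ∨ (0 < D.μ₂ ∧ Function.Injective D.C)) :
    ∃ R : ℝ, ∀ k, ‖X k‖ ≤ R := by
  have := fact_one_le_of_eq hβ
  have := fact_one_le_of_eq hγ
  obtain ⟨K, e, hK, he0, hbd, hlow, hkey⟩ := hrun.exists_estimate hα hβ hγ hμ₁ hμ₂ hA hlam_pos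
    hlam hε hτ hξ hεlam hτlam hξlam
  obtain ⟨Y, hY⟩ := feasible_nonempty hγ hρ hA
  rcases hpos with hpos | ⟨hpos, hinj⟩
  · obtain ⟨c, hc, hXc⟩ := exists_frobNorm_le_schattenSeminorm m n hα
    refine exists_bound_of_eventually_le
      (R := c * ((D.objective Y + 1 + (D.objective (X 0) + 1 * K ^ 2)) / D.μ₁)) ?_
    filter_upwards [he0.eventually_le_const one_pos, hlam.eventually_le_const one_pos,
      eventually_ge_atTop 1] with k hek hlk hk
    rw [← frobNorm_eq_norm]
    refine (hXc _).trans (mul_le_mul_of_nonneg_left ?_ hc)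
    rw [le_div_iff₀ hpos, mul_comm, schattenSeminorm_apply]
    have hobj : ∀ Z, 0 ≤ D.objective Z := fun Z => by
      rw [objective_eq_splitObjective hβ]
      exact splitObjective_nonneg hα hβ hμ₁ hμ₂ _ _
    have hl := hlam_pos k hk
    -- Rule (a) bounds μ₁‖σ(X)‖ through the objective estimate; rule (b) imposes such a bound,
    -- finite because the multipliers are bounded.
    rcases hrun.accept k hk with hacc | ⟨-, -, hacc⟩
    · have h1 := hlow k hk Y hY hacc
      have h2 : 0 ≤ D.μ₂ * lrNorm D.β (s k) :=
        mul_nonneg hμ₂ (apply_nonneg (lrSeminorm p D.β) (s k))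
      rw [splitObjective] at h1
      linarith [hobj (X 0), sq_nonneg K]
    · have h2 := sq_mul_sq_add_sq_le (l := 1) (norm_nonneg (θ₁ k)) (norm_nonneg (θ₂ k))
        (hbd k hk).1 (hbd k hk).2.1
      have h3 : lam k / 2 * (‖θ₁ k‖ ^ 2 + ‖θ₂ k‖ ^ 2) ≤
          1 ^ 2 / 2 * (‖θ₁ k‖ ^ 2 + ‖θ₂ k‖ ^ 2) := by
        gcongr
        linarith
      linarith [hobj Y]
  · obtain ⟨M, hM⟩ := D.C.exists_leftInverse_of_injective (LinearMap.ker_eq_bot.mpr hinj)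
    obtain ⟨c, hc, hMc⟩ := M.exists_norm_le_mul
    have hs2 := norm_le_sqrt_mul_lrNorm (k := p) D.β
    set a : ℝ := √p
    have ha : 0 ≤ a := Real.sqrt_nonneg _
    -- A left inverse of C recovers X from C X, which equals d - s up to the residual, so only s
    -- needs a bound.
    have hXk : ∀ k, 1 ≤ k → lam k ≤ 1 →
        ‖X k‖ ≤ c * (2 * K + ‖D.d‖ + a * lrNorm D.β (s k)) := by
      intro k hk hlk
      have h1 : M (D.C (X k)) = X k := LinearMap.congr_fun hM (X k)
      rw [← h1]
      refine (hMc _).trans (mul_le_mul_of_nonneg_left ?_ hc)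
      have h2 : D.C (X k) = (D.C (X k) + s k - D.d) + D.d - s k := by abel
      rw [h2]
      refine (norm_sub_le _ _).trans (add_le_add ((norm_add_le _ _).trans ?_) (hs2 _))
      have h3 := mul_le_mul_of_nonneg_left hlk (mul_nonneg zero_le_two hK)
      linarith [(hbd k hk).2.2.2]
    set c₁ := ‖Y‖ + c * (2 * K + ‖D.d‖) + ‖D.d - D.C Y‖ with hc₁
    set c₂ := c * a + a with hc₂
    have hc₂0 : 0 ≤ c₂ := by positivity
    have hc₁0 : 0 ≤ c₁ := by positivity
    have ht₁ : Tendsto (fun k => τ k / lam k * c₁) atTop (𝓝 0) := by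
      simpa using hτlam.mul_const c₁
    have ht₂ : Tendsto (fun k => τ k / lam k * c₂) atTop (𝓝 0) := by
      simpa using hτlam.mul_const c₂
    -- The distance term is at most (τ/λ)(c₁ + c₂‖s‖_β). Eventually its constant part is at most 1
    -- and its slope at most μ₂/2, so half of μ₂‖s‖_β absorbs it; the 2 is 1 for `e` plus 1 for the
    -- constant part.
    refine exists_bound_of_eventually_le
      (R := c * (2 * K + ‖D.d‖ + a * ((D.objective Y + 2) / (D.μ₂ / 2)))) ?_
    filter_upwards [he0.eventually_le_const one_pos, hlam.eventually_le_const one_pos,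
      ht₁.eventually_le_const one_pos, ht₂.eventually_le_const (half_pos hpos),
      eventually_ge_atTop 1] with k hek hlk h₁ h₂ hk
    have hS0 : 0 ≤ lrNorm D.β (s k) := apply_nonneg (lrSeminorm p D.β) (s k)
    refine (hXk k hk hlk).trans ?_
    gcongr
    rw [le_div_iff₀ (half_pos hpos)]
    have h1 := hkey k hk Y hY
    have h2 : ‖Y - X k‖ + ‖D.d - D.C Y - s k‖ ≤ c₁ + c₂ * lrNorm D.β (s k) := by
      have h3 := norm_sub_le Y (X k)
      have h4 := norm_sub_le (D.d - D.C Y) (s k)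
      have h5 := hXk k hk hlk
      have h6 := hs2 (s k)
      rw [hc₁, hc₂]
      linarith
    have h3 := mul_le_mul_of_nonneg_left h2 (div_nonneg (hτ k hk) (hlam_pos k hk).le)
    have h4 := mul_le_mul_of_nonneg_right h₂ hS0
    have h5 : 0 ≤ D.μ₁ * lrNorm D.α (singularVector (X k)) :=
      mul_nonneg hμ₁ (apply_nonneg (schattenSeminorm m n hα) (X k))
    rw [splitObjective] at h1
    linarith

/-- Vanishing residuals force y → b - A X̄ and s → d - C X̄. The closed γ-ball gives feasibility;
the distances to the lift of Y converge, so the factor τ/λ kills that error. -/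
theorem IsFALC.isOptimal_of_tendsto (hrun : D.IsFALC lam ε τ ξ X s y θ₁ θ₂)
    (hα : D.α = 1 ∨ D.α = 2 ∨ D.α = ∞) (hβ : D.β = 1 ∨ D.β = 2 ∨ D.β = ∞)
    (hγ : D.γ = 1 ∨ D.γ = 2 ∨ D.γ = ∞)
    (hμ₁ : 0 ≤ D.μ₁) (hμ₂ : 0 ≤ D.μ₂) (hA : Function.Surjective D.A)
    (hlam_pos : ∀ k, 1 ≤ k → 0 < lam k) (hlam : Tendsto lam atTop (𝓝 0))
    (hε : ∀ k, 1 ≤ k → 0 ≤ ε k) (hτ : ∀ k, 1 ≤ k → 0 ≤ τ k) (hξ : ∀ k, 1 ≤ k → 0 ≤ ξ k)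
    (hεlam : ∃ B : ℝ, 0 < B ∧ ∀ k, 1 ≤ k → ε k / lam k ^ 2 ≤ B)
    (hτlam : Tendsto (fun k => τ k / lam k) atTop (𝓝 0))
    (hξlam : Tendsto (fun k => ξ k / lam k) atTop (𝓝 0))
    {Xbar : Matrix (Fin m) (Fin n) ℝ} {φ : ℕ → ℕ} (hφ : StrictMono φ)
    (hX : Tendsto (fun j => X (φ j)) atTop (𝓝 Xbar)) : D.IsOptimal Xbar := by
  have := fact_one_le_of_eq hβ
  have := fact_one_le_of_eq hγ
  obtain ⟨K, e, hK, he0, hbd, hlow, hkey⟩ := hrun.exists_estimate hα hβ hγ hμ₁ hμ₂ hA hlam_pos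
    hlam hε hτ hξ hεlam hτlam hξlam
  have hφ' := hφ.tendsto_atTop
  have hφ1 : ∀ᶠ j in atTop, 1 ≤ φ j := hφ'.eventually_ge_atTop 1
  have hr : Tendsto (fun j => 2 * K * lam (φ j)) atTop (𝓝 0) := by
    simpa using (hlam.comp hφ').const_mul (2 * K)
  have hr₁ : Tendsto (fun j => D.A (X (φ j)) + y (φ j) - D.b) atTop (𝓝 0) :=
    squeeze_zero_norm' (hφ1.mono fun j hj => (hbd _ hj).2.2.1) hr
  have hr₂ : Tendsto (fun j => D.C (X (φ j)) + s (φ j) - D.d) atTop (𝓝 0) :=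
    squeeze_zero_norm' (hφ1.mono fun j hj => (hbd _ hj).2.2.2) hr
  have hAX : Tendsto (fun j => D.A (X (φ j))) atTop (𝓝 (D.A Xbar)) :=
    (D.A.continuous_of_finiteDimensional.tendsto _).comp hX
  have hCX : Tendsto (fun j => D.C (X (φ j))) atTop (𝓝 (D.C Xbar)) :=
    (D.C.continuous_of_finiteDimensional.tendsto _).comp hX
  have hy : Tendsto (fun j => y (φ j)) atTop (𝓝 (D.b - D.A Xbar)) := by
    have h := (hr₁.sub hAX).add_const D.b
    rw [show (0 : EuclideanSpace ℝ (Fin q)) - D.A Xbar + D.b = D.b - D.A Xbar by abel] at h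
    refine h.congr fun j => ?_
    abel
  have hs : Tendsto (fun j => s (φ j)) atTop (𝓝 (D.d - D.C Xbar)) := by
    have h := (hr₂.sub hCX).add_const D.d
    rw [show (0 : EuclideanSpace ℝ (Fin p)) - D.C Xbar + D.d = D.d - D.C Xbar by abel] at h
    refine h.congr fun j => ?_
    abel
  refine ⟨?_, fun Y hY => ?_⟩
  · have h1 : lrSeminorm q D.γ (D.b - D.A Xbar) ≤ D.ρ :=
      le_of_tendsto (((lrSeminorm q D.γ).continuous_of_finiteDimensional_real.tendsto _).comp hy)
        (hφ1.mono fun j hj => hrun.y_mem _ hj)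
    rw [map_sub_rev] at h1
    exact h1
  · have h1 : Tendsto (fun j => D.splitObjective (X (φ j)) (s (φ j))) atTop
        (𝓝 (D.objective Xbar)) := by
      rw [objective_eq_splitObjective hβ]
      exact tendsto_splitObjective hα hβ hX hs
    have h2 : Tendsto (fun j => D.objective Y + e (φ j) + τ (φ j) / lam (φ j) *
        (‖Y - X (φ j)‖ + ‖D.d - D.C Y - s (φ j)‖)) atTop (𝓝 (D.objective Y)) := by
      have h3 := ((he0.comp hφ').const_add (D.objective Y)).add ((hτlam.comp hφ').mul
        ((hX.const_sub Y).norm.add (hs.const_sub (D.d - D.C Y)).norm))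
      rw [zero_mul, add_zero, add_zero] at h3
      exact h3
    exact le_of_tendsto_of_tendsto h1 h2 (hφ1.mono fun j hj => hkey _ hj Y hY)

end Frobenius

end CompositeProblem

end

theorem theorem1 {m n p q : ℕ} (D : CompositeProblem m n p q)
    (hα : D.α = 1 ∨ D.α = 2 ∨ D.α = ∞)
    (hβ : D.β = 1 ∨ D.β = 2 ∨ D.β = ∞)
    (hγ : D.γ = 1 ∨ D.γ = 2 ∨ D.γ = ∞)
    (hμ₁ : 0 ≤ D.μ₁) (hμ₂ : 0 ≤ D.μ₂) (hρ : 0 ≤ D.ρ)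
    (hA : Function.Surjective D.A)
    (lam ε τ ξ : ℕ → ℝ)
    (hlam_pos : ∀ k, 1 ≤ k → 0 < lam k)
    (hlam : DecreasesToZero lam)
    (hε : DecreasesToZero ε)
    (hεlam : ∃ B : ℝ, 0 < B ∧ ∀ k, 1 ≤ k → ε k / lam k ^ 2 ≤ B)
    (hτ : DecreasesToZero τ)
    (hξ : DecreasesToZero ξ)
    (hτlam : Tendsto (fun k => τ k / lam k) atTop (𝓝 0))
    (hξlam : Tendsto (fun k => ξ k / lam k) atTop (𝓝 0))
    (X : ℕ → Matrix (Fin m) (Fin n) ℝ)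
    (s : ℕ → EuclideanSpace ℝ (Fin p)) (y : ℕ → EuclideanSpace ℝ (Fin q))
    (θ₁ : ℕ → EuclideanSpace ℝ (Fin q)) (θ₂ : ℕ → EuclideanSpace ℝ (Fin p))
    (hrun : D.IsFALC lam ε τ ξ X s y θ₁ θ₂) :
    ((0 < D.μ₁ ∨ (0 < D.μ₂ ∧ Function.Injective D.C)) →
      ∃ R : ℝ, ∀ k, frobNorm (X k) ≤ R) ∧
    ∀ Xbar : Matrix (Fin m) (Fin n) ℝ,
      (∃ φ : ℕ → ℕ, StrictMono φ ∧ Tendsto (fun j => X (φ j)) atTop (𝓝 Xbar)) →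
      D.IsOptimal Xbar := by
  refine ⟨fun hpos => ?_, fun Xbar ⟨φ, hφ, hX⟩ => ?_⟩
  · simpa only [CompositeProblem.frobNorm_eq_norm] using
      hrun.exists_norm_le hα hβ hγ hμ₁ hμ₂ hρ hA hlam_pos hlam.2
      (fun _ hk => hε.nonneg hk) (fun _ hk => hτ.nonneg hk) (fun _ hk => hξ.nonneg hk)
      hεlam hτlam hξlam hpos
  · exact hrun.isOptimal_of_tendsto hα hβ hγ hμ₁ hμ₂ hA hlam_pos hlam.2
      (fun _ hk => hε.nonneg hk) (fun _ hk => hτ.nonneg hk) (fun _ hk => hξ.nonneg hk)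
      hεlam hτlam hξlam hφ hX
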